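/- Let $n\ge 1$, let $T\in\mathbb C^{n\times n}$ be a Hermitian matrix whose eigenvalues $\lambda_1\le\dots\le\lambda_n$ (listed with multiplicity) are not all equal (so $n\ge 2$), and let $a$ be a random vector uniformly distributed (normalized surface measure) on the complex unit sphere $\{z\in\mathbb C^n: |z|=1\}$. Write $x_+^m=x^m$ if $x>0$ and $x_+^m=0$ if $x\le 0$ (for $m=0$ as well, so that $x_+^0$ is the Heaviside step). For real knots $x_1,\dots,x_n$ that are not all equal, the fundamental B-spline $M_{n-1}(t;x_1,\dots,x_n)$ is the divided difference, at the nodes $x_1,\dots,x_n$ counted with multiplicity, of the function $y\mapsto (n-1)(y-t)_+^{n-2}$. Here, for nodes $x_1\le\dots\le x_k$ in nondecreasing order, $f[x_1,\dots,x_k]=f^{(k-1)}(x_1)/(k-1)!$ if $x_1=x_k$, and $f[x_1,\dots,x_k]=\dfrac{f[x_2,\dots,x_k]-f[x_1,\dots,x_{k-1}]}{x_k-x_1}$ otherwise, with the convention that a derivative is assigned the value $0$ at a point where it does not exist (this occurs only if $t$ is a knot). Then the real random variable $a^\dagger T a$ has a probability density function $p_n(t;T)$ with respect to Lebesgue measure,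 and for almost every $t$ $$p_n(t;T)=M_{n-1}(t;\lambda_1,\dots,\lambda_n).$$ If moreover the eigenvalues are pairwise distinct, then for every $t\in\mathbb R$ $$M_{n-1}(t;\lambda_1,\dots,\lambda_n)=(n-1)\sum_{k=1}^n\frac{(\lambda_k-t)_+^{\,n-2}}{\prod_{i\ne k}(\lambda_k-\lambda_i)} .$$ This applies to any observable $a^\dagger Oa$ with $O$ Hermitian. In particular, for all complex matrices $\tau$ (of size $m\times n$, $m\ge 0$) and $\rho$ (of size $n\times n$), the transmittance matrix $\tau^\dagger\tau$, the reflectance matrix $\rho^\dagger\rho$ and the absorptivity matrix $I-\tau^\dagger\tau-\rho^\dagger\rho$ are Hermitian, so the statement covers each of them whenever its eigenvalues are not all equal. -/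

import Mathlib

open MeasureTheory ProbabilityTheory Matrix

noncomputable section

namespace CoherentTransport

/-- The truncated power `x_+ ^ m`, with the convention `x_+ ^ 0 = 1` for `0 < x` and
`x_+ ^ 0 = 0` for `x ≤ 0` (so `x_+ ^ 0` is the Heaviside step, not the constant `1`). -/
def truncPow (m : ℕ) (x : ℝ) : ℝ := if 0 < x then x ^ m else 0

theorem truncPow_eq_max_pow {m : ℕ} (hm : m ≠ 0) (x : ℝ) : truncPow m x = (max x 0) ^ m := by
  unfold truncPow
  split_ifs with h
  · rw [max_eq_left h.le]
  · rw [max_eq_right (not_lt.mp h), zero_pow hm]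

/-- The divided difference `f[x₁, …, xₙ]` for nodes `x₁ ≤ ⋯ ≤ xₙ` listed in nondecreasing order,
repeated nodes being allowed: if all `n` nodes agree it is `f^(n-1)(x₁) / (n-1)!`, and otherwise
`(f[x₂, …, xₙ] - f[x₁, …, xₙ₋₁]) / (xₙ - x₁)`. -/
def sortedDividedDiff (f : ℝ → ℝ) : (n : ℕ) → (Fin n → ℝ) → ℝ
  | 0, _ => 0
  | 1, x => f (x 0)
  | n + 2, x =>
    if x 0 = x (Fin.last (n + 1)) then
      iteratedDeriv (n + 1) f (x 0) / (Nat.factorial (n + 1) : ℝ)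
    else
      (sortedDividedDiff f (n + 1) (fun i => x i.succ) -
        sortedDividedDiff f (n + 1) (fun i => x i.castSucc)) / (x (Fin.last (n + 1)) - x 0)

/-- The divided difference of `f` at the `n` nodes `x i` (with multiplicity, in any order). -/
def dividedDiff (f : ℝ → ℝ) {n : ℕ} (x : Fin n → ℝ) : ℝ :=
  sortedDividedDiff f n (x ∘ Tuple.sort x)

/-- The fundamental B-spline `M_{n-1}(t; x₁, …, xₙ)` of Curry and Schoenberg: the divided
difference, in the variable `y`, of `(n - 1) (y - t)_+ ^ (n - 2)` at the knots `x₁, …, xₙ`.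
It is meant for `n ≥ 2` knots that are not all equal. -/
def fundamentalBSpline {n : ℕ} (x : Fin n → ℝ) (t : ℝ) : ℝ :=
  dividedDiff (fun y => ((n : ℝ) - 1) * truncPow (n - 2) (y - t)) x

/-- The complex unit sphere in `ℂⁿ`. -/
abbrev ComplexSphere (n : ℕ) : Type :=
  Metric.sphere (0 : EuclideanSpace ℂ (Fin n)) 1

/-- The uniform distribution on the complex unit sphere: surface measure, normalized to have
total mass one. -/
def uniformOnSphere (n : ℕ) : Measure (ComplexSphere n) :=
  ((volume : Measure (EuclideanSpace ℂ (Fin n))).toSphere Set.univ)⁻¹ •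
    (volume : Measure (EuclideanSpace ℂ (Fin n))).toSphere

/-- The observable `a† O a`, as a real number (for Hermitian `O` its imaginary part vanishes). -/
def observable {n : ℕ} (O : Matrix (Fin n) (Fin n) ℂ) (a : EuclideanSpace ℂ (Fin n)) : ℝ :=
  (star a.ofLp ⬝ᵥ (O *ᵥ a.ofLp)).re

theorem coe_observable {n : ℕ} {O : Matrix (Fin n) (Fin n) ℂ} (hO : O.IsHermitian)
    (a : EuclideanSpace ℂ (Fin n)) :
    (observable O a : ℂ) = star a.ofLp ⬝ᵥ (O *ᵥ a.ofLp) := by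
  apply Complex.ext
  · simp [observable]
  · have h := hO.im_star_dotProduct_mulVec_self a.ofLp
    simpa using h.symm

/-- The transmittance matrix `T = τ† τ`. -/
def transmittance {m n : ℕ} (τ : Matrix (Fin m) (Fin n) ℂ) : Matrix (Fin n) (Fin n) ℂ :=
  τᴴ * τ

/-- The reflectance matrix `R = ρ† ρ`. -/
def reflectance {n : ℕ} (ρ : Matrix (Fin n) (Fin n) ℂ) : Matrix (Fin n) (Fin n) ℂ :=
  ρᴴ * ρ

/-- The absorptivity matrix `A = I - τ† τ - ρ† ρ`. -/
def absorptivity {m n : ℕ} (τ : Matrix (Fin m) (Fin n) ℂ) (ρ : Matrix (Fin n) (Fin n) ℂ) :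
    Matrix (Fin n) (Fin n) ℂ :=
  1 - τᴴ * τ - ρᴴ * ρ

end CoherentTransport

end

namespace CoherentTransport

/-! Method of moments. Fix `A` below all eigenvalues. Both `a† T a` and the B-spline have `q`-th
moment about `A` equal to `(n-1)! q! / (n+q-1)! * h_q(λ - A)`, with `h_q` the complete homogeneous
symmetric polynomial, `completeHom`.

On the spline side, integrating `(t - A)^q` against `(y - t)_+^m` is a Beta integral, a multiple of
`(y - A)^(m+q+1)`. The divided difference passes through the integral, and divided differences of
powers are the `h_q` (`sortedDividedDiff_sub_const_pow`,
`integrableOn_and_integral_fundamentalBSpline`).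

On the sphere side, the moment is the angular factor of a Gaussian integral over `ℂⁿ`. After
diagonalization this integral splits over coordinates, and `∫ |z|^(2k) e^(-|z|²) = π k!` cancels the
multinomial coefficients, leaving the sum of all monomials of degree `q`
(`integral_observable_sub_pow`).

By Weierstrass approximation, finite measures on a bounded interval are determined by their moments.
The spline is not assumed nonnegative, so its positive and negative parts are treated as two
measures (`absolutelyContinuous_and_rnDeriv_of_moments`). -/

/-! ### Complete homogeneous symmetric polynomials. -/

/-- The complete homogeneous symmetric polynomial of degree `q`, evaluated at `x`. -/
noncomputable def completeHom {n : ℕ} (x : Fin n → ℝ) (q : ℕ) : ℝ :=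
  PowerSeries.coeff q (∏ i, PowerSeries.mk fun k => x i ^ k)

theorem one_sub_mul_mk_pow (a : ℝ) :
    (1 - PowerSeries.C a * PowerSeries.X) * (PowerSeries.mk fun k => a ^ k) = 1 := by
  ext k
  rcases k with _ | k
  · simp [sub_mul, mul_assoc]
  · simp [sub_mul, mul_assoc, PowerSeries.coeff_succ_X_mul, PowerSeries.coeff_one, pow_succ']

theorem completeHom_comp_equiv {n : ℕ} (x : Fin n → ℝ) (σ : Equiv.Perm (Fin n)) (q : ℕ) :
    completeHom (x ∘ σ) q = completeHom x q := by
  unfold completeHom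
  congr 1
  exact Equiv.prod_comp σ fun i => PowerSeries.mk fun k => x i ^ k

/-- With generating function `G = ∏ 1 / (1 - x_i X)`, dropping a node multiplies `G` by `1 - x_i X`.
Dropping the first and dropping the last thus differ by `(x_last - x_0) X G`. This is the divided
difference recursion. -/
theorem sub_mul_completeHom {n : ℕ} (x : Fin (n + 2) → ℝ) (q : ℕ) :
    (x (Fin.last (n + 1)) - x 0) * completeHom x q =
      completeHom (fun i => x i.succ) (q + 1) - completeHom (fun i => x i.castSucc) (q + 1) := by
  unfold completeHom
  have h0 := Fin.prod_univ_succ fun i => PowerSeries.mk fun k => x i ^ k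
  have hl := Fin.prod_univ_castSucc fun i => PowerSeries.mk fun k => x i ^ k
  have e0 := one_sub_mul_mk_pow (x 0)
  have el := one_sub_mul_mk_pow (x (Fin.last (n + 1)))
  set G := ∏ i, PowerSeries.mk fun k => x i ^ k
  set S := ∏ i : Fin (n + 1), PowerSeries.mk fun k => x i.succ ^ k
  set I := ∏ i : Fin (n + 1), PowerSeries.mk fun k => x i.castSucc ^ k
  have hS : S = (1 - PowerSeries.C (x 0) * PowerSeries.X) * G := by
    rw [h0, ← mul_assoc, e0, one_mul]
  have hI : I = (1 - PowerSeries.C (x (Fin.last (n + 1))) * PowerSeries.X) * G := by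
    rw [hl, mul_comm I, ← mul_assoc, el, one_mul]
  rw [hS, hI]
  simp only [sub_mul, mul_assoc, one_mul, map_sub, PowerSeries.coeff_C_mul,
    PowerSeries.coeff_succ_X_mul]
  ring

theorem completeHom_const (n : ℕ) (a : ℝ) (q : ℕ) :
    completeHom (fun _ : Fin (n + 1) => a) q = (n + q).choose n * a ^ q := by
  unfold completeHom
  have h : (PowerSeries.mk fun k => a ^ k) = PowerSeries.rescale a (PowerSeries.mk 1) := by
    ext k; simp
  rw [Finset.prod_const, Finset.card_univ, Fintype.card_fin, h, ← map_pow,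
    PowerSeries.mk_one_pow_eq_mk_choose_add]
  simp [mul_comm]

/-! ### Divided differences of powers and at distinct nodes. -/

theorem iteratedDeriv_sub_const_pow (c : ℝ) (k N : ℕ) (y : ℝ) :
    iteratedDeriv k (fun y => (y - c) ^ N) y = N.descFactorial k * (y - c) ^ (N - k) := by
  have h := congrFun (iteratedDeriv_comp_sub_const k (fun y : ℝ => y ^ N) c) y
  rw [h, iteratedDeriv_pow]

theorem eq_const_of_monotone {n : ℕ} {x : Fin (n + 1) → ℝ} (hx : Monotone x)
    (h : x 0 = x (Fin.last n)) : x = fun _ => x 0 := by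
  funext i
  exact le_antisymm (h ▸ hx (Fin.le_last i)) (hx (Fin.zero_le i))

theorem sortedDividedDiff_sub_const_pow (c : ℝ) : ∀ (k j : ℕ) (x : Fin (k + 1) → ℝ),
    Monotone x → sortedDividedDiff (fun y => (y - c) ^ (k + j)) (k + 1) x =
      completeHom (fun i => x i - c) j := by
  intro k
  induction k with
  | zero =>
    intro j x _
    simp [sortedDividedDiff, completeHom]
  | succ k ih =>
    intro j x hx
    rw [sortedDividedDiff]
    split_ifs with h
    -- At a fully repeated node, the Taylor coefficient and the number of monomials of degree `j`
    -- are the same binomial coefficient.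
    · rw [eq_const_of_monotone hx h, completeHom_const, iteratedDeriv_sub_const_pow,
        Nat.choose_eq_descFactorial_div_factorial,
        Nat.cast_div (Nat.factorial_dvd_descFactorial _ _) (by positivity)]
      rw [Nat.add_sub_cancel_left]
      ring
    · have e : k + 1 + j = k + (j + 1) := by ring
      rw [e, ih _ (fun i => x i.succ) (hx.comp Fin.strictMono_succ.monotone),
        ih _ (fun i => x i.castSucc) (hx.comp Fin.strictMono_castSucc.monotone), div_eq_iff
        (sub_ne_zero.2 (Ne.symm h)), ← sub_mul_completeHom (fun i => x i - c)]
      ring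

theorem sortedDividedDiff_const_mul (c : ℝ) (f : ℝ → ℝ) : ∀ (n : ℕ) (x : Fin n → ℝ),
    sortedDividedDiff (fun y => c * f y) n x = c * sortedDividedDiff f n x
  | 0, _ => by simp [sortedDividedDiff]
  | 1, _ => by simp [sortedDividedDiff]
  | n + 2, x => by
    rw [sortedDividedDiff, sortedDividedDiff, sortedDividedDiff_const_mul c f (n + 1),
      sortedDividedDiff_const_mul c f (n + 1), iteratedDeriv_const_mul_field]
    split_ifs <;> ring

theorem sortedDividedDiff_of_injective (f : ℝ → ℝ) : ∀ (n : ℕ) (x : Fin n → ℝ),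
    Function.Injective x → sortedDividedDiff f n x =
      ∑ k, f (x k) / ∏ i ∈ Finset.univ.erase k, (x k - x i)
  | 0, _, _ => by simp [sortedDividedDiff]
  | 1, x, _ => by
    simp [sortedDividedDiff]
  | n + 2, x, hx => by
    have hne : x 0 ≠ x (Fin.last (n + 1)) := hx.ne (by simp [Fin.ext_iff])
    -- Omitting node `p` puts a factor `x_k - x_p` in the numerator; it vanishes at `k = p`, so the
    -- sum may run over all nodes. Subtracting the cases `p = last` and `p = 0` leaves the factor
    -- `x_last - x_0`.
    have key : ∀ (p : Fin (n + 2)) (j : Fin (n + 1)),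
        f (x (p.succAbove j)) / ∏ i ∈ Finset.univ.erase j, (x (p.succAbove j) - x (p.succAbove i)) =
          f (x (p.succAbove j)) * (x (p.succAbove j) - x p) /
            ∏ i ∈ Finset.univ.erase (p.succAbove j), (x (p.succAbove j) - x i) := by
      intro p j
      have hs : Finset.univ.erase (p.succAbove j) =
          insert p ((Finset.univ.erase j).map p.succAboveEmb) := by
        ext i
        rcases Fin.eq_self_or_eq_succAbove p i with rfl | ⟨i, rfl⟩ <;>
          simp [Fin.succAbove_ne, (Fin.succAbove_ne _ _).symm]
      have hp : x (p.succAbove j) - x p ≠ 0 := sub_ne_zero.2 (hx.ne (Fin.succAbove_ne _ _))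
      rw [hs, Finset.prod_insert (by simp), Finset.prod_map, mul_comm (f _),
        mul_div_mul_left _ _ hp]
      rfl
    have tot : ∀ p : Fin (n + 2), ∑ j : Fin (n + 1),
        f (x (p.succAbove j)) / ∏ i ∈ Finset.univ.erase j, (x (p.succAbove j) - x (p.succAbove i)) =
          ∑ k, f (x k) * (x k - x p) / ∏ i ∈ Finset.univ.erase k, (x k - x i) := by
      intro p
      rw [Fin.sum_univ_succAbove _ p]
      simp [key p]
    have t0 := tot 0
    have tl := tot (Fin.last _)
    simp only [Fin.succAbove_zero, Fin.succAbove_last] at t0 tl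
    rw [sortedDividedDiff, if_neg hne,
      sortedDividedDiff_of_injective f (n + 1) (fun i => x i.succ) (hx.comp (Fin.succ_injective _)),
      sortedDividedDiff_of_injective f (n + 1) (fun i => x i.castSucc) (hx.comp (Fin.castSucc_injective _)),
      t0, tl, ← Finset.sum_sub_distrib, div_eq_iff (sub_ne_zero.2 hne.symm), Finset.sum_mul]
    refine Finset.sum_congr rfl fun k _ => ?_
    ring

theorem dividedDiff_of_injective (f : ℝ → ℝ) {n : ℕ} (x : Fin n → ℝ)
    (hx : Function.Injective x) :
    dividedDiff f x = ∑ k, f (x k) / ∏ i ∈ Finset.univ.erase k, (x k - x i) := by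
  rw [dividedDiff, sortedDividedDiff_of_injective _ _ _ (hx.comp (Tuple.sort x).injective),
    ← Equiv.sum_comp (Tuple.sort x) (fun k => f (x k) / ∏ i ∈ Finset.univ.erase k, (x k - x i))]
  refine Finset.sum_congr rfl fun k _ => ?_
  congr 1
  refine Finset.prod_equiv (Tuple.sort x) (by simp) (by simp)

/-! ### Moments of the B-spline. -/

theorem iteratedDeriv_truncPow (m k : ℕ) {t x : ℝ} (h : t ≠ x) :
    iteratedDeriv k (fun y => truncPow m (y - t)) x =
      m.descFactorial k * truncPow (m - k) (x - t) := by
  rcases lt_or_gt_of_ne h with h | h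
  · have e : (fun y => truncPow m (y - t)) =ᶠ[nhds x] fun y => (y - t) ^ m := by
      filter_upwards [lt_mem_nhds h] with y hy
      simp [truncPow, hy]
    rw [e.iteratedDeriv_eq, iteratedDeriv_sub_const_pow]
    simp [truncPow, h]
  · have e : (fun y => truncPow m (y - t)) =ᶠ[nhds x] fun _ => 0 := by
      filter_upwards [gt_mem_nhds h] with y hy
      simp [truncPow, hy.le]
    rw [e.iteratedDeriv_eq, iteratedDeriv_const]
    simp [truncPow, h.le]

/-- A Beta integral: integration by parts trades a power of `x - t` for one of `t - A`, with
vanishing boundary terms. -/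
theorem integral_sub_pow_mul_sub_pow (A x : ℝ) : ∀ p q : ℕ,
    ∫ t in A..x, (x - t) ^ p * (t - A) ^ q =
      p.factorial * q.factorial / (p + q + 1).factorial * (x - A) ^ (p + q + 1)
  | 0, q => by
    have h := intervalIntegral.integral_comp_sub_right (a := A) (b := x) (fun t => t ^ q) A
    simp only [pow_zero, one_mul, h, integral_pow]
    simp only [sub_self, zero_add, Nat.factorial_succ, Nat.cast_mul, Nat.factorial_zero]
    push_cast
    have := q.factorial_ne_zero
    field_simp
    simp
  | p + 1, q => by
    have hu : ∀ t ∈ Set.uIcc A x,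
        HasDerivAt (fun t => (x - t) ^ (p + 1)) (-((p + 1 : ℝ) * (x - t) ^ p)) t := by
      intro t _
      have := ((hasDerivAt_id t).const_sub x).pow (p + 1)
      refine this.congr_deriv ?_
      simp
    have hv : ∀ t ∈ Set.uIcc A x,
        HasDerivAt (fun t => (t - A) ^ (q + 1) / (q + 1 : ℝ)) ((t - A) ^ q) t := by
      intro t _
      have := (((hasDerivAt_id t).sub_const A).pow (q + 1)).div_const (q + 1 : ℝ)
      refine this.congr_deriv ?_
      simp only [id, Nat.add_sub_cancel]
      push_cast
      field_simp
    have h := intervalIntegral.integral_mul_deriv_eq_deriv_mul hu hv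
      (Continuous.intervalIntegrable (by fun_prop) _ _)
      (Continuous.intervalIntegrable (by fun_prop) _ _)
    have e : ∀ t : ℝ, -((p + 1 : ℝ) * (x - t) ^ p) * ((t - A) ^ (q + 1) / (q + 1 : ℝ)) =
        -((p + 1 : ℝ) / (q + 1)) * ((x - t) ^ p * (t - A) ^ (q + 1)) := fun t => by
      field_simp
    rw [h]
    simp only [e, intervalIntegral.integral_const_mul, integral_sub_pow_mul_sub_pow A x p (q + 1),
      Nat.factorial_succ q, Nat.factorial_succ p]
    rw [show p + (q + 1) + 1 = p + 1 + q + 1 by ring]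
    push_cast
    have := (p + 1 + q + 1).factorial_ne_zero
    simp
    field_simp

theorem integrableOn_and_integral_sub_pow_mul_truncPow {A B x : ℝ} (hA : A < x) (hB : x < B)
    (p q : ℕ) :
    IntegrableOn (fun t => (t - A) ^ q * truncPow p (x - t)) (Set.Ioc A B) ∧
    ∫ t in Set.Ioc A B, (t - A) ^ q * truncPow p (x - t) =
      p.factorial * q.factorial / (p + q + 1).factorial * (x - A) ^ (p + q + 1) := by
  have e : (fun t => (t - A) ^ q * truncPow p (x - t)) =
      (Set.Iio x).indicator fun t => (x - t) ^ p * (t - A) ^ q := by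
    funext t
    by_cases h : t < x
    · simp [truncPow, h, mul_comm]
    · simp [truncPow, h]
  have hi : IntegrableOn (fun t => (x - t) ^ p * (t - A) ^ q) (Set.Ioc A B) :=
    (Continuous.integrableOn_Icc (by fun_prop)).mono_set Set.Ioc_subset_Icc_self
  rw [e]
  refine ⟨hi.indicator measurableSet_Iio, ?_⟩
  have hs : Set.Ioc A B ∩ Set.Iio x = Set.Ioo A x := by
    ext t
    simp only [Set.mem_inter_iff, Set.mem_Ioc, Set.mem_Iio, Set.mem_Ioo]
    constructor
    · rintro ⟨⟨h1, _⟩, h3⟩; exact ⟨h1, h3⟩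
    · rintro ⟨h1, h3⟩; exact ⟨⟨h1, (h3.trans hB).le⟩, h3⟩
  rw [setIntegral_indicator measurableSet_Iio, hs, ← integral_Ioc_eq_integral_Ioo,
    ← intervalIntegral.integral_of_le hA.le, integral_sub_pow_mul_sub_pow]

/-- The condition on `k` keeps every confluent derivative at order at most `m`. The derivative of
order `m + 1` would be a point mass at the knot, which the pointwise derivative misses. -/
theorem integrableOn_and_integral_sortedDividedDiff_truncPow (A B : ℝ) (m q : ℕ) :
    ∀ (k : ℕ) (x : Fin (k + 1) → ℝ), Monotone x → (∀ i, A < x i ∧ x i < B) →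
      (k ≤ m ∨ k = m + 1 ∧ x 0 ≠ x (Fin.last k)) →
      IntegrableOn (fun t => (t - A) ^ q *
        sortedDividedDiff (fun y => truncPow m (y - t)) (k + 1) x) (Set.Ioc A B) ∧
      ∫ t in Set.Ioc A B, (t - A) ^ q *
        sortedDividedDiff (fun y => truncPow m (y - t)) (k + 1) x =
        m.factorial * q.factorial / (m + q + 1).factorial *
          sortedDividedDiff (fun y => (y - A) ^ (m + q + 1)) (k + 1) x := by
  intro k
  induction k with
  | zero =>
    intro x _ hAB _
    simpa [sortedDividedDiff] using
      integrableOn_and_integral_sub_pow_mul_truncPow (hAB 0).1 (hAB 0).2 m q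
  | succ k ih =>
    intro x hx hAB hk
    by_cases h : x 0 = x (Fin.last (k + 1))
    · have hkm : k + 1 ≤ m := by
        rcases hk with hk | hk
        · exact hk
        · exact absurd h hk.2
      obtain ⟨hi, hint⟩ :=
        integrableOn_and_integral_sub_pow_mul_truncPow (hAB 0).1 (hAB 0).2 (m - (k + 1)) q
      have hae : (fun t => (m.descFactorial (k + 1) / (k + 1).factorial : ℝ) *
          ((t - A) ^ q * truncPow (m - (k + 1)) (x 0 - t))) =ᵐ[volume.restrict (Set.Ioc A B)]
          fun t => (t - A) ^ q *
            sortedDividedDiff (fun y => truncPow m (y - t)) (k + 1 + 1) x := by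
        refine ae_restrict_of_ae ?_
        -- The value assigned to the derivative at the knot affects only a null set of `t`.
        filter_upwards [Measure.ae_ne volume (x 0)] with t ht
        rw [sortedDividedDiff, if_pos h, iteratedDeriv_truncPow m (k + 1) ht]
        ring
      refine ⟨(hi.const_mul _).congr hae, ?_⟩
      rw [← integral_congr_ae hae, integral_const_mul, hint, sortedDividedDiff, if_pos h,
        iteratedDeriv_sub_const_pow]
      have e1 : m - (k + 1) + q + 1 = m + q + 1 - (k + 1) := by omega
      have f1 := Nat.factorial_mul_descFactorial hkm
      have f2 := Nat.factorial_mul_descFactorial (show k + 1 ≤ m + q + 1 by omega)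
      rw [e1, ← f1, ← f2]
      have h1 := (k + 1).factorial_ne_zero
      have h2 := (m + q + 1 - (k + 1)).factorial_ne_zero
      have h3 : (m + q + 1).descFactorial (k + 1) ≠ 0 := by
        simp only [ne_eq, Nat.descFactorial_eq_zero_iff_lt]; omega
      push_cast
      field_simp
    · have hkm : k ≤ m := by omega
      obtain ⟨i1, e1⟩ := ih (fun i => x i.succ) (hx.comp Fin.strictMono_succ.monotone)
        (fun i => hAB _) (Or.inl hkm)
      obtain ⟨i2, e2⟩ := ih (fun i => x i.castSucc) (hx.comp Fin.strictMono_castSucc.monotone)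
        (fun i => hAB _) (Or.inl hkm)
      have e : ∀ f : ℝ → ℝ, sortedDividedDiff f (k + 1 + 1) x =
          (sortedDividedDiff f (k + 1) (fun i => x i.succ) -
            sortedDividedDiff f (k + 1) (fun i => x i.castSucc)) /
              (x (Fin.last (k + 1)) - x 0) := fun f => by
        rw [sortedDividedDiff, if_neg h]
      have e' : ∀ t, (t - A) ^ q *
          sortedDividedDiff (fun y => truncPow m (y - t)) (k + 1 + 1) x =
          ((t - A) ^ q * sortedDividedDiff (fun y => truncPow m (y - t)) (k + 1)
              (fun i => x i.succ) -
            (t - A) ^ q * sortedDividedDiff (fun y => truncPow m (y - t)) (k + 1)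
              (fun i => x i.castSucc)) / (x (Fin.last (k + 1)) - x 0) := fun t => by
        rw [e]; ring
      simp only [e']
      refine ⟨(i1.sub i2).div_const _, ?_⟩
      rw [integral_div, integral_sub i1 i2, e1, e2, e]
      ring

theorem integrableOn_and_integral_fundamentalBSpline {n : ℕ} {x : Fin n → ℝ}
    (hne : ∃ i j, x i ≠ x j) {A B : ℝ} (hAB : ∀ i, A < x i ∧ x i < B) (q : ℕ) :
    IntegrableOn (fun t => (t - A) ^ q * fundamentalBSpline x t) (Set.Ioc A B) ∧
    ∫ t in Set.Ioc A B, (t - A) ^ q * fundamentalBSpline x t =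
      (n - 1).factorial * q.factorial / (n + q - 1).factorial *
        completeHom (fun i => x i - A) q := by
  obtain ⟨i, j, hij⟩ := hne
  obtain ⟨m, rfl⟩ : ∃ m, n = m + 2 := by
    have h1 := i.2
    have h2 := j.2
    have h3 : (i : ℕ) ≠ j := fun h => hij (by rw [Fin.ext h])
    exact ⟨n - 2, by omega⟩
  have hmono := Tuple.monotone_sort x
  have hends : (x ∘ Tuple.sort x) 0 ≠ (x ∘ Tuple.sort x) (Fin.last (m + 1)) := by
    intro h
    have hc := eq_const_of_monotone hmono h
    have hc' : ∀ i, x i = (x ∘ Tuple.sort x) 0 := fun i => by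
      have := congrFun hc ((Tuple.sort x).symm i)
      simpa using this
    exact hij ((hc' i).trans (hc' j).symm)
  obtain ⟨hi, he⟩ := integrableOn_and_integral_sortedDividedDiff_truncPow A B m q (m + 1)
    (x ∘ Tuple.sort x) hmono (fun i => hAB _) (Or.inr ⟨rfl, hends⟩)
  have e : ∀ t, (t - A) ^ q * fundamentalBSpline x t = (m + 1 : ℝ) * ((t - A) ^ q *
      sortedDividedDiff (fun y => truncPow m (y - t)) (m + 2) (x ∘ Tuple.sort x)) := fun t => by
    rw [fundamentalBSpline, dividedDiff, sortedDividedDiff_const_mul]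
    push_cast
    ring
  simp only [e]
  refine ⟨hi.const_mul _, ?_⟩
  have hs := completeHom_comp_equiv (fun i => x i - A) (Tuple.sort x) q
  have hp := sortedDividedDiff_sub_const_pow A (m + 1) q _ hmono
  rw [show m + 1 + q = m + q + 1 by ring] at hp
  rw [integral_const_mul, he, hp, ← hs, show m + 2 + q - 1 = m + q + 1 by omega,
    show m + 2 - 1 = m + 1 from rfl, Nat.factorial_succ m]
  push_cast
  simp only [Function.comp_def]
  ring

/-! ### Gaussian integrals in polar and Cartesian coordinates. -/

theorem integral_homogeneous_mul_exp_neg_norm_sq {E : Type*} [NormedAddCommGroup E]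
    [NormedSpace ℝ E] [Nontrivial E] [FiniteDimensional ℝ E] [MeasurableSpace E] [BorelSpace E]
    (μ : Measure E) [μ.IsAddHaarMeasure] {F : E → ℝ} {d : ℕ}
    (hF : ∀ (r : ℝ) (x : E), F (r • x) = r ^ d * F x) :
    ∫ x, F x * Real.exp (-‖x‖ ^ 2) ∂μ =
      (∫ a, F a ∂μ.toSphere) * ∫ r in Set.Ioi (0 : ℝ),
        r ^ (Module.finrank ℝ E - 1) * (r ^ d * Real.exp (-r ^ 2)) := by
  calc
    _ = ∫ x : ({(0)}ᶜ : Set E), F x.1 * Real.exp (-‖x.1‖ ^ 2) ∂(μ.comap (↑)) := by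
      rw [integral_subtype_comap (measurableSet_singleton _).compl
        fun x ↦ F x * Real.exp (-‖x‖ ^ 2), restrict_compl_singleton]
    _ = ∫ x, F x.1 * (x.2.1 ^ d * Real.exp (-x.2.1 ^ 2))
          ∂μ.toSphere.prod (.volumeIoiPow (Module.finrank ℝ E - 1)) := by
      rw [← μ.measurePreserving_homeomorphUnitSphereProd.integral_comp
        (Homeomorph.measurableEmbedding _)]
      refine integral_congr_ae (.of_forall fun x => ?_)
      have hx : ‖x.1‖ ≠ 0 := norm_ne_zero_iff.2 x.2
      have h : F x.1 = ‖x.1‖ ^ d * F (‖x.1‖⁻¹ • x.1) := by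
        rw [← hF, smul_smul, mul_inv_cancel₀ hx, one_smul]
      simp only [homeomorphUnitSphereProd_apply_snd_coe, homeomorphUnitSphereProd_apply_fst_coe]
      rw [h]
      ring
    _ = (∫ a, F a ∂μ.toSphere) * ∫ r : Set.Ioi (0 : ℝ), r.1 ^ d * Real.exp (-r.1 ^ 2)
          ∂.volumeIoiPow (Module.finrank ℝ E - 1) :=
      integral_prod_mul (fun a : Metric.sphere (0 : E) 1 => F a)
        fun r : Set.Ioi (0 : ℝ) => r.1 ^ d * Real.exp (-r.1 ^ 2)
    _ = _ := by
      congr 1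
      simp only [Measure.volumeIoiPow, ENNReal.ofReal]
      rw [integral_withDensity_eq_integral_smul,
        integral_subtype_comap measurableSet_Ioi fun a : ℝ ↦
          Real.toNNReal (a ^ (Module.finrank ℝ E - 1)) • (a ^ d * Real.exp (-a ^ 2)),
        setIntegral_congr_fun measurableSet_Ioi fun x hx ↦ ?_]
      · rw [NNReal.smul_def, Real.coe_toNNReal _ (pow_nonneg (le_of_lt hx) _), smul_eq_mul]
      · exact (measurable_subtype_coe.pow_const _).real_toNNReal

theorem integral_pow_mul_exp_neg_sq (n : ℕ) :
    ∫ r in Set.Ioi (0 : ℝ), r ^ (2 * n + 1) * Real.exp (-r ^ 2) = n.factorial / 2 := by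
  have h := integral_rpow_mul_exp_neg_rpow (p := 2) (q := (2 * n + 1 : ℕ)) (by norm_num)
    (by linarith [(2 * n + 1 : ℕ).cast_nonneg (α := ℝ)])
  have e : ((2 * n + 1 : ℕ) + 1 : ℝ) / 2 = n + 1 := by push_cast; ring
  rw [e, Real.Gamma_nat_eq_factorial] at h
  simp only [Real.rpow_natCast, Real.rpow_ofNat] at h
  rw [h]
  ring

theorem integral_complex_norm_sq_pow_mul_exp (k : ℕ) :
    ∫ z : ℂ, (‖z‖ ^ 2) ^ k * Real.exp (-‖z‖ ^ 2) = Real.pi * k.factorial := by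
  have h := Complex.integral_rpow_mul_exp_neg_rpow (p := 2) (q := (2 * k : ℕ)) (by norm_num)
    (by linarith [(2 * k : ℕ).cast_nonneg (α := ℝ)])
  have e : ((2 * k : ℕ) + 2 : ℝ) / 2 = k + 1 := by push_cast; ring
  rw [e, Real.Gamma_nat_eq_factorial] at h
  simp only [Real.rpow_natCast, Real.rpow_ofNat] at h
  simp only [← pow_mul]
  rw [h]
  ring

theorem integrable_complex_norm_sq_pow_mul_exp (k : ℕ) :
    Integrable fun z : ℂ => (‖z‖ ^ 2) ^ k * Real.exp (-‖z‖ ^ 2) := by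
  -- The integral of a non-integrable function is `0` by convention, whereas this one is positive.
  by_contra h
  have h1 := integral_complex_norm_sq_pow_mul_exp k
  rw [integral_undef h] at h1
  have := Real.pi_pos
  have : 0 < Real.pi * k.factorial := by positivity
  linarith

theorem completeHom_eq_sum {n : ℕ} (x : Fin n → ℝ) (q : ℕ) :
    completeHom x q = ∑ k ∈ Finset.piAntidiag Finset.univ q, ∏ i, x i ^ k i := by
  rw [completeHom, PowerSeries.coeff_prod]
  refine Finset.sum_bij (fun l _ => (l : Fin n → ℕ)) ?_ ?_ ?_ ?_
  · intro l hl
    simpa using hl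
  · intro l _ l' _ h
    exact DFunLike.coe_injective h
  · intro k hk
    exact ⟨Finsupp.equivFunOnFinite.symm k, by simpa using hk, rfl⟩
  · simp

theorem integral_pi_complex_form_pow_mul_exp {n : ℕ} (c : Fin n → ℝ) (q : ℕ) :
    ∫ z : Fin n → ℂ, (∑ i, c i * ‖z i‖ ^ 2) ^ q * Real.exp (-∑ i, ‖z i‖ ^ 2) =
      Real.pi ^ n * q.factorial * completeHom c q := by
  have e : ∀ z : Fin n → ℂ, (∑ i, c i * ‖z i‖ ^ 2) ^ q * Real.exp (-∑ i, ‖z i‖ ^ 2) =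
      ∑ k ∈ Finset.piAntidiag Finset.univ q, (Nat.multinomial Finset.univ k : ℝ) *
        ((∏ i, c i ^ k i) * ∏ i, ((‖z i‖ ^ 2) ^ k i * Real.exp (-‖z i‖ ^ 2))) := by
    intro z
    rw [Finset.sum_pow_eq_sum_piAntidiag, ← Finset.sum_neg_distrib, Real.exp_sum, Finset.sum_mul]
    refine Finset.sum_congr rfl fun k _ => ?_
    simp only [mul_pow, Finset.prod_mul_distrib]
    ring
  simp only [e]
  rw [integral_finsetSum]
  · rw [completeHom_eq_sum, Finset.mul_sum]
    refine Finset.sum_congr rfl fun k hk => ?_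
    rw [integral_const_mul, integral_const_mul,
      integral_fintype_prod_volume_eq_prod
        (fun i (z : ℂ) => (‖z‖ ^ 2) ^ k i * Real.exp (-‖z‖ ^ 2))]
    simp only [integral_complex_norm_sq_pow_mul_exp, Finset.prod_mul_distrib, Finset.prod_const,
      Finset.card_univ, Fintype.card_fin]
    have hs := Nat.multinomial_spec Finset.univ k
    have hq : ∑ i, k i = q := by simpa using hk
    rw [hq] at hs
    rw [← hs]
    push_cast
    ring
  · intro k _
    refine Integrable.const_mul (Integrable.const_mul ?_ _) _
    exact Integrable.fintype_prod (f := fun i (z : ℂ) => (‖z‖ ^ 2) ^ k i * Real.exp (-‖z‖ ^ 2))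
      fun i => integrable_complex_norm_sq_pow_mul_exp (k i)

/-- Uniqueness of Haar measure up to scale suffices: `c` cancels once the surface measure is
normalized. -/
theorem exists_integral_euclidean_eq (n : ℕ) : ∃ c : ℝ, 0 < c ∧
    ∀ f : EuclideanSpace ℂ (Fin n) → ℝ,
      ∫ z, f z = c * ∫ z : Fin n → ℂ, f (WithLp.toLp 2 z) := by
  let L : (Fin n → ℂ) ≃L[ℝ] EuclideanSpace ℂ (Fin n) :=
    (PiLp.continuousLinearEquiv 2 ℝ fun _ : Fin n => ℂ).symm
  have : (Measure.map L (volume : Measure (Fin n → ℂ))).IsAddHaarMeasure :=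
    L.isAddHaarMeasure_map _
  obtain ⟨c, hc⟩ : ∃ c : NNReal, c = Measure.addHaarScalarFactor
    (volume : Measure (EuclideanSpace ℂ (Fin n)))
      (Measure.map L (volume : Measure (Fin n → ℂ))) := ⟨_, rfl⟩
  have h := Measure.isAddLeftInvariant_eq_smul (volume : Measure (EuclideanSpace ℂ (Fin n)))
    (Measure.map L (volume : Measure (Fin n → ℂ)))
  have hpos := Measure.addHaarScalarFactor_pos_of_isAddHaarMeasure
    (volume : Measure (EuclideanSpace ℂ (Fin n)))
    (Measure.map L (volume : Measure (Fin n → ℂ)))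
  rw [← hc] at h hpos
  refine ⟨c, hpos, fun f => ?_⟩
  have hL : MeasurableEmbedding L := L.toHomeomorph.measurableEmbedding
  rw [h, integral_smul_nnreal_measure, hL.integral_map]
  rfl

/-! ### Moments of the observable. -/

theorem observable_eq_sum {n : ℕ} {T : Matrix (Fin n) (Fin n) ℂ} (hT : T.IsHermitian)
    (a : EuclideanSpace ℂ (Fin n)) :
    observable T a = ∑ i, hT.eigenvalues i * ‖hT.eigenvectorBasis.repr a i‖ ^ 2 := by
  have hsymm := isSymmetric_toEuclideanLin_iff.mpr hT
  have hin : (observable T a : ℂ) = inner ℂ a (toEuclideanLin T a) := by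
    rw [coe_observable hT, EuclideanSpace.inner_eq_star_dotProduct, dotProduct_comm]
    rfl
  have heig : ∀ i, toEuclideanLin T (hT.eigenvectorBasis i) =
      (hT.eigenvalues i : ℂ) • hT.eigenvectorBasis i := by
    intro i
    apply WithLp.ofLp_injective
    have := hT.mulVec_eigenvectorBasis i
    simpa using this
  have h : (observable T a : ℂ) =
      ((∑ i, hT.eigenvalues i * ‖hT.eigenvectorBasis.repr a i‖ ^ 2 : ℝ) : ℂ) := by
    rw [hin, ← hT.eigenvectorBasis.sum_inner_mul_inner]
    push_cast
    refine Finset.sum_congr rfl fun i _ => ?_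
    rw [← hsymm, heig, inner_smul_left, OrthonormalBasis.repr_apply_apply,
      ← inner_conj_symm a, Complex.conj_ofReal, mul_left_comm, ← Complex.conj_mul']
  exact_mod_cast h

theorem integral_observable_sub_mul_exp {n : ℕ} {T : Matrix (Fin n) (Fin n) ℂ}
    (hT : T.IsHermitian) (A : ℝ) (q : ℕ) :
    ∫ z : EuclideanSpace ℂ (Fin n), (observable T z - A * ‖z‖ ^ 2) ^ q * Real.exp (-‖z‖ ^ 2) =
      ∫ z : EuclideanSpace ℂ (Fin n),
        (∑ i, (hT.eigenvalues i - A) * ‖z i‖ ^ 2) ^ q * Real.exp (-∑ i, ‖z i‖ ^ 2) := by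
  let U : EuclideanSpace ℂ (Fin n) ≃ₗᵢ[ℝ] EuclideanSpace ℂ (Fin n) :=
    ⟨hT.eigenvectorBasis.repr.toLinearEquiv.restrictScalars ℝ,
      hT.eigenvectorBasis.repr.norm_map⟩
  have hU : MeasurePreserving U := U.measurePreserving
  rw [← hU.integral_comp U.toHomeomorph.measurableEmbedding fun z : EuclideanSpace ℂ (Fin n) =>
    (∑ i, (hT.eigenvalues i - A) * ‖z i‖ ^ 2) ^ q * Real.exp (-∑ i, ‖z i‖ ^ 2)]
  refine integral_congr_ae (.of_forall fun z => ?_)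
  have hn : ∑ i, ‖U z i‖ ^ 2 = ‖z‖ ^ 2 := by
    rw [← EuclideanSpace.norm_sq_eq, U.norm_map]
  simp only [sub_mul, Finset.sum_sub_distrib, ← Finset.mul_sum, hn]
  rw [observable_eq_sum hT]
  rfl

theorem observable_smul {n : ℕ} (T : Matrix (Fin n) (Fin n) ℂ) (r : ℝ)
    (z : EuclideanSpace ℂ (Fin n)) : observable T (r • z) = r ^ 2 * observable T z := by
  have h : (r • z).ofLp = (r : ℂ) • z.ofLp := by
    ext i; simp
  rw [observable, observable, h, mulVec_smul, star_smul, smul_dotProduct, dotProduct_smul,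
    smul_smul, smul_eq_mul]
  simp [pow_two]

theorem integral_observable_sub_pow {n : ℕ} (hn : 0 < n) {T : Matrix (Fin n) (Fin n) ℂ}
    (hT : T.IsHermitian) (A : ℝ) (q : ℕ) :
    ∫ a : ComplexSphere n, (observable T a - A) ^ q ∂uniformOnSphere n =
      (n - 1).factorial * q.factorial / (n + q - 1).factorial *
        completeHom (fun i => hT.eigenvalues i - A) q := by
  have : NeZero n := ⟨hn.ne'⟩
  obtain ⟨c, hc, hcf⟩ := exists_integral_euclidean_eq n
  have hdim : Module.finrank ℝ (EuclideanSpace ℂ (Fin n)) = 2 * n := by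
    rw [finrank_real_of_complex, finrank_euclideanSpace_fin]
  have key : ∀ q : ℕ, (∫ a : ComplexSphere n, (observable T a - A) ^ q
      ∂(volume : Measure (EuclideanSpace ℂ (Fin n))).toSphere) * ((n + q - 1).factorial / 2) =
        c * (Real.pi ^ n * q.factorial * completeHom (fun i => hT.eigenvalues i - A) q) := by
    intro q
    -- The term `A * ‖z‖ ^ 2` equals `A` on the sphere and makes the integrand homogeneous of degree
    -- `2 * q`.
    have hF : ∀ (r : ℝ) (z : EuclideanSpace ℂ (Fin n)),
        (observable T (r • z) - A * ‖r • z‖ ^ 2) ^ q =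
          r ^ (2 * q) * (observable T z - A * ‖z‖ ^ 2) ^ q := by
      intro r z
      rw [observable_smul, norm_smul, mul_pow, Real.norm_eq_abs, sq_abs, mul_left_comm, ← mul_sub,
        mul_pow, pow_mul]
    have h := integral_homogeneous_mul_exp_neg_norm_sq
      (volume : Measure (EuclideanSpace ℂ (Fin n)))
      (F := fun z => (observable T z - A * ‖z‖ ^ 2) ^ q) hF
    rw [integral_observable_sub_mul_exp hT, hcf] at h
    have h2 := integral_pi_complex_form_pow_mul_exp (fun i => hT.eigenvalues i - A) q
    simp only at h
    rw [h2, hdim] at h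
    rw [h]
    congr 1
    · refine integral_congr_ae (.of_forall fun a => ?_)
      simp
    · rw [← integral_pow_mul_exp_neg_sq]
      refine integral_congr_ae (.of_forall fun r => ?_)
      simp only
      rw [← mul_assoc, ← pow_add]
      congr 2
      omega
  -- The case `q = 0` gives the total surface measure; dividing by it removes `c` and the power of
  -- `π`.
  have h0 := key 0
  have hq := key q
  simp only [pow_zero, integral_const, smul_eq_mul, mul_one, Nat.factorial_zero,
    Nat.cast_one, add_zero] at h0
  have hH : completeHom (fun i => hT.eigenvalues i - A) 0 = 1 := by
    simp [completeHom_eq_sum]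
  rw [hH, mul_one, measureReal_def] at h0
  rw [uniformOnSphere, integral_smul_measure, ENNReal.toReal_inv, smul_eq_mul]
  have f1 : ((n + q - 1).factorial : ℝ) ≠ 0 := by positivity
  have f2 : ((n - 1).factorial : ℝ) ≠ 0 := by positivity
  have hπ : Real.pi ^ n ≠ 0 := pow_ne_zero _ Real.pi_ne_zero
  have hσ : ((volume : Measure (EuclideanSpace ℂ (Fin n))).toSphere Set.univ).toReal =
      2 * (c * Real.pi ^ n) / (n - 1).factorial := by
    rw [eq_div_iff f2]; linarith
  have hS : ∫ a : ComplexSphere n, (observable T a - A) ^ q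
      ∂(volume : Measure (EuclideanSpace ℂ (Fin n))).toSphere =
        2 * (c * (Real.pi ^ n * q.factorial * completeHom (fun i => hT.eigenvalues i - A) q)) /
          (n + q - 1).factorial := by
    rw [eq_div_iff f1]; linarith
  rw [hσ, hS]
  have := hc.ne'
  field_simp

/-! ### Recovering a measure and its density from moments. -/

theorem integrable_continuous_of_ae_mem_Icc {μ : Measure ℝ} [IsFiniteMeasure μ] {A B : ℝ}
    (hμ : ∀ᵐ t ∂μ, t ∈ Set.Icc A B) {f : ℝ → ℝ} (hf : Continuous f) : Integrable f μ := by
  obtain ⟨C, hC⟩ := isCompact_Icc.exists_bound_of_continuousOn (hf.continuousOn (s := Set.Icc A B))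
  exact Integrable.of_bound hf.aestronglyMeasurable C (hμ.mono hC)

theorem measure_eq_of_moments_eq {μ ν : Measure ℝ} [IsFiniteMeasure μ] [IsFiniteMeasure ν]
    {A B : ℝ} (hμ : ∀ᵐ t ∂μ, t ∈ Set.Icc A B) (hν : ∀ᵐ t ∂ν, t ∈ Set.Icc A B)
    (h : ∀ q : ℕ, ∫ t, (t - A) ^ q ∂μ = ∫ t, (t - A) ^ q ∂ν) : μ = ν := by
  have hpoly : ∀ p : Polynomial ℝ, ∫ t, p.eval (t - A) ∂μ = ∫ t, p.eval (t - A) ∂ν := by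
    intro p
    simp only [Polynomial.eval_eq_sum_range]
    rw [integral_finsetSum _ fun i _ => integrable_continuous_of_ae_mem_Icc hμ (by fun_prop),
      integral_finsetSum _ fun i _ => integrable_continuous_of_ae_mem_Icc hν (by fun_prop)]
    simp only [integral_const_mul, h]
  refine ext_of_forall_integral_eq_of_IsFiniteMeasure fun f => ?_
  refine eq_of_abs_sub_le_all fun ε hε => ?_
  -- The summand `1` keeps `K` positive even if both measures vanish.
  set K := μ.real Set.univ + ν.real Set.univ + 1
  have hK : 0 < K := by positivity
  obtain ⟨p, hp⟩ := exists_polynomial_near_of_continuousOn 0 (B - A) (fun s => f (s + A))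
    (by fun_prop) (ε / K) (by positivity)
  have hb : ∀ t ∈ Set.Icc A B, ‖f t - p.eval (t - A)‖ ≤ ε / K := by
    intro t ht
    have := hp (t - A) ⟨by linarith [ht.1], by linarith [ht.2]⟩
    rw [sub_add_cancel, abs_sub_comm] at this
    exact this.le
  have hc : Continuous fun t => p.eval (t - A) := by fun_prop
  have est : ∀ (ρ : Measure ℝ) [IsFiniteMeasure ρ], (∀ᵐ t ∂ρ, t ∈ Set.Icc A B) →
      |(∫ t, f t ∂ρ) - ∫ t, p.eval (t - A) ∂ρ| ≤ ε / K * ρ.real Set.univ := by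
    intro ρ _ hρ
    rw [← integral_sub (integrable_continuous_of_ae_mem_Icc hρ f.continuous)
      (integrable_continuous_of_ae_mem_Icc hρ hc)]
    exact norm_integral_le_of_norm_le_const (hρ.mono hb)
  have h1 := est μ hμ
  have h2 := est ν hν
  rw [hpoly] at h1
  calc |(∫ t, f t ∂μ) - ∫ t, f t ∂ν| ≤ ε / K * μ.real Set.univ + ε / K * ν.real Set.univ := by
        rw [abs_sub_comm] at h2
        exact (abs_sub_le _ _ _).trans (add_le_add h1 h2)
    _ = ε / K * (K - 1) := by simp only [K]; ring
    _ ≤ ε / K * K := by gcongr; linarith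
    _ = ε := by field_simp

/-- As `M` may a priori change sign, the moments are used to prove `ν + M⁻ dt = M⁺ dt` between
genuine measures. This gives `ν ≤ M⁺ dt`, hence absolute continuity, and comparing densities gives
`M`. -/
theorem absolutelyContinuous_and_rnDeriv_of_moments {ν : Measure ℝ} [IsFiniteMeasure ν] {A B : ℝ}
    (hν : ∀ᵐ t ∂ν, t ∈ Set.Icc A B) {M : ℝ → ℝ}
    (hM : ∀ q : ℕ, IntegrableOn (fun t => (t - A) ^ q * M t) (Set.Ioc A B) ∧
      ∫ t in Set.Ioc A B, (t - A) ^ q * M t = ∫ t, (t - A) ^ q ∂ν) :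
    ν ≪ volume ∧ ∀ᵐ t, t ∈ Set.Ioc A B → (ν.rnDeriv volume t).toReal = M t := by
  set S := Set.Ioc A B
  have hS : MeasurableSet S := measurableSet_Ioc
  have hM0 : IntegrableOn M S := by simpa using (hM 0).1
  have hp : AEMeasurable (fun t => ENNReal.ofReal (M t)) (volume.restrict S) :=
    hM0.aemeasurable.ennreal_ofReal
  have hm : AEMeasurable (fun t => ENNReal.ofReal (-M t)) (volume.restrict S) :=
    hM0.aemeasurable.neg.ennreal_ofReal
  have := isFiniteMeasure_withDensity_ofReal hM0.2
  have := isFiniteMeasure_withDensity_ofReal hM0.neg.2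
  have hsupp : ∀ g : ℝ → ENNReal, ∀ᵐ t ∂(volume.restrict S).withDensity g, t ∈ Set.Icc A B :=
    fun g => (withDensity_absolutelyContinuous _ g).ae_le
      ((ae_restrict_mem hS).mono fun t ht => Set.Ioc_subset_Icc_self ht)
  have hbd : ∀ (g : ℝ → ℝ) (_ : AEStronglyMeasurable g (volume.restrict S)) (q : ℕ),
      (∀ t, |g t| ≤ |M t|) → IntegrableOn (fun t => g t * (t - A) ^ q) S := by
    intro g hg q hgM
    refine Integrable.mono (hM q).1
      (hg.mul (Continuous.aestronglyMeasurable (by fun_prop))) (.of_forall fun t => ?_)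
    rw [norm_mul, norm_mul, mul_comm]
    exact mul_le_mul_of_nonneg_left (hgM t) (norm_nonneg _)
  have key : ν + (volume.restrict S).withDensity (fun t => ENNReal.ofReal (-M t)) =
      (volume.restrict S).withDensity fun t => ENNReal.ofReal (M t) := by
    refine measure_eq_of_moments_eq (A := A) (B := B)
      (ae_add_measure_iff.2 ⟨hν, hsupp _⟩) (hsupp _) fun q => ?_
    have hc : Continuous fun t : ℝ => (t - A) ^ q := by fun_prop
    rw [integral_add_measure (integrable_continuous_of_ae_mem_Icc hν hc)
        (integrable_continuous_of_ae_mem_Icc (hsupp _) hc),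
      integral_withDensity_eq_integral_toReal_smul₀ hm (by simp),
      integral_withDensity_eq_integral_toReal_smul₀ hp (by simp), ← (hM q).2, ← eq_sub_iff_add_eq]
    simp only [ENNReal.toReal_ofReal', smul_eq_mul]
    have i1 := hbd (fun t => max (M t) 0)
      (hM0.aemeasurable.max aemeasurable_const).aestronglyMeasurable q fun t => by
        rcases le_total 0 (M t) with h | h <;> simp [h]
    have i2 := hbd (fun t => max (-M t) 0)
      (hM0.aemeasurable.neg.max aemeasurable_const).aestronglyMeasurable q fun t => by
        rcases le_total 0 (M t) with h | h <;> simp [h]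
    rw [← integral_sub i1 i2]
    refine integral_congr_ae (.of_forall fun t => ?_)
    rcases le_total 0 (M t) with h | h <;> simp [h, mul_comm]
  have hac : ν ≪ volume := by
    have h1 : ν ≤ (volume.restrict S).withDensity fun t => ENNReal.ofReal (M t) := by
      rw [← key]; exact Measure.le_add_right le_rfl
    exact (h1.absolutelyContinuous.trans (withDensity_absolutelyContinuous _ _)).trans
      Measure.restrict_le_self.absolutelyContinuous
  refine ⟨hac, ?_⟩
  have h2 := congrArg (fun μ => μ.restrict S) key
  simp only [Measure.restrict_add] at h2
  have h3 : ν.restrict S = (volume.restrict S).withDensity (ν.rnDeriv volume) := by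
    rw [← restrict_withDensity hS, Measure.withDensity_rnDeriv_eq _ _ hac]
  rw [restrict_withDensity hS, restrict_withDensity hS, Measure.restrict_restrict hS,
    Set.inter_self, h3, ← withDensity_add_left (Measure.measurable_rnDeriv _ _)] at h2
  have h4 := (withDensity_eq_iff_of_sigmaFinite
    ((Measure.measurable_rnDeriv _ _).aemeasurable.add hm) hp).1 h2
  rw [Filter.EventuallyEq, ae_restrict_iff' hS] at h4
  filter_upwards [h4, ν.rnDeriv_lt_top volume] with t ht hfin hmem
  have h5 := congrArg ENNReal.toReal (ht hmem)
  rw [Pi.add_apply, ENNReal.toReal_add hfin.ne ENNReal.ofReal_ne_top, ENNReal.toReal_ofReal',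
    ENNReal.toReal_ofReal'] at h5
  -- Where `M t ≤ 0`, a sum of two nonnegative terms is `0`, so the density and `M t` both vanish.
  rcases le_total 0 (M t) with h | h
  · simpa [h] using h5
  · simp only [h, max_eq_right, Left.nonneg_neg_iff, max_eq_left] at h5
    linarith

/-! ### The density of the observable. -/

theorem continuous_observable {n : ℕ} (T : Matrix (Fin n) (Fin n) ℂ) :
    Continuous (observable T) := by
  unfold observable
  refine Complex.continuous_re.comp ?_
  have h : Continuous fun a : EuclideanSpace ℂ (Fin n) => a.ofLp := PiLp.continuous_ofLp 2 _
  exact h.star.dotProduct (continuous_const.matrix_mulVec h)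

theorem observable_mem_Icc {n : ℕ} {T : Matrix (Fin n) (Fin n) ℂ} (hT : T.IsHermitian)
    {A B : ℝ} (hAB : ∀ i, A < hT.eigenvalues i ∧ hT.eigenvalues i < B) (a : ComplexSphere n) :
    observable T a ∈ Set.Icc A B := by
  have hn : ∑ i, ‖hT.eigenvectorBasis.repr a.1 i‖ ^ 2 = 1 := by
    rw [← EuclideanSpace.norm_sq_eq, LinearIsometryEquiv.norm_map]
    simp
  rw [observable_eq_sum hT]
  constructor
  · calc A = ∑ i, A * ‖hT.eigenvectorBasis.repr a.1 i‖ ^ 2 := by rw [← Finset.mul_sum, hn, mul_one]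
      _ ≤ _ := Finset.sum_le_sum fun i _ =>
        mul_le_mul_of_nonneg_right (hAB i).1.le (sq_nonneg _)
  · calc _ ≤ ∑ i, B * ‖hT.eigenvectorBasis.repr a.1 i‖ ^ 2 := Finset.sum_le_sum fun i _ =>
        mul_le_mul_of_nonneg_right (hAB i).2.le (sq_nonneg _)
      _ = B := by rw [← Finset.mul_sum, hn, mul_one]

theorem absolutelyContinuous_and_rnDeriv_map_observable {n : ℕ}
    [IsFiniteMeasure (uniformOnSphere n)] {T : Matrix (Fin n) (Fin n) ℂ}
    (hT : T.IsHermitian) (hne : ∃ i j, hT.eigenvalues i ≠ hT.eigenvalues j) :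
    Measure.map (fun a : ComplexSphere n => observable T a) (uniformOnSphere n) ≪ volume ∧
    ∀ᵐ t, ((Measure.map (fun a : ComplexSphere n => observable T a)
      (uniformOnSphere n)).rnDeriv volume t).toReal = fundamentalBSpline hT.eigenvalues t := by
  have hX : Measurable fun a : ComplexSphere n => observable T a :=
    (continuous_observable T).measurable.comp measurable_subtype_coe
  have hn : 0 < n := hne.choose.pos
  obtain ⟨R, hR⟩ : ∃ R : ℝ, ∀ i, |hT.eigenvalues i| < R := by
    refine ⟨∑ i, |hT.eigenvalues i| + 1, fun i => ?_⟩
    have := Finset.single_le_sum (f := fun i => |hT.eigenvalues i|)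
      (fun i _ => abs_nonneg _) (Finset.mem_univ i)
    linarith
  -- Each bounded interval identifies the density only inside itself. The countably many intervals
  -- indexed by `N` exhaust the line, so no separate argument that the spline vanishes outside the
  -- spectrum is needed.
  have key : ∀ N : ℕ, _ := fun N => by
    have hAB : ∀ i, -(R + N) < hT.eigenvalues i ∧ hT.eigenvalues i < R + N := fun i => by
      rw [← abs_lt]; linarith [hR i, N.cast_nonneg (α := ℝ)]
    refine absolutelyContinuous_and_rnDeriv_of_moments (A := -(R + N)) (B := R + N)
      (ν := Measure.map (fun a : ComplexSphere n => observable T a) (uniformOnSphere n))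
      (M := fundamentalBSpline hT.eigenvalues) ?_ fun q => ?_
    · refine (ae_map_iff hX.aemeasurable measurableSet_Icc).2 ?_
      exact .of_forall fun a => observable_mem_Icc hT hAB a
    · obtain ⟨h1, h2⟩ := integrableOn_and_integral_fundamentalBSpline hne hAB q
      refine ⟨h1, ?_⟩
      rw [h2, integral_map hX.aemeasurable (by fun_prop),
        integral_observable_sub_pow hn hT]
  refine ⟨(key 0).1, ?_⟩
  filter_upwards [ae_all_iff.2 fun N => (key N).2] with t ht
  obtain ⟨N, hN⟩ := exists_nat_gt (|t| - R)
  obtain ⟨h1, h2⟩ := abs_lt.1 (show |t| < R + N by linarith)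
  exact ht N ⟨h1, h2.le⟩

end CoherentTransport

theorem mainTheorem1 {n : ℕ} {Ω : Type*} [MeasurableSpace Ω] (P : Measure Ω)
    [IsProbabilityMeasure P] (a : Ω → CoherentTransport.ComplexSphere n)
    (ha : HasLaw a (CoherentTransport.uniformOnSphere n) P) :
    (∀ (T : Matrix (Fin n) (Fin n) ℂ) (hT : T.IsHermitian),
      (∃ i j, hT.eigenvalues i ≠ hT.eigenvalues j) →
        HasPDF (fun ω => CoherentTransport.observable T (a ω)) P volume ∧
        (fun t => (pdf (fun ω => CoherentTransport.observable T (a ω)) P volume t).toReal)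
          =ᵐ[volume] CoherentTransport.fundamentalBSpline hT.eigenvalues ∧
        (Function.Injective hT.eigenvalues →
          ∀ t : ℝ, CoherentTransport.fundamentalBSpline hT.eigenvalues t =
            ((n : ℝ) - 1) * ∑ k : Fin n,
              CoherentTransport.truncPow (n - 2) (hT.eigenvalues k - t) /
                ∏ i ∈ Finset.univ.erase k, (hT.eigenvalues k - hT.eigenvalues i))) ∧
    (∀ (m : ℕ) (τ : Matrix (Fin m) (Fin n) ℂ) (ρ : Matrix (Fin n) (Fin n) ℂ),
      (CoherentTransport.transmittance τ).IsHermitian ∧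
      (CoherentTransport.reflectance ρ).IsHermitian ∧
      (CoherentTransport.absorptivity τ ρ).IsHermitian) := by
  refine ⟨fun T hT hne => ?_, fun m τ ρ => ?_⟩
  · have hprob : IsProbabilityMeasure (CoherentTransport.uniformOnSphere n) := by
      rw [← ha.map_eq]; exact Measure.isProbabilityMeasure_map ha.aemeasurable
    have hX : Measurable fun a : CoherentTransport.ComplexSphere n =>
        CoherentTransport.observable T a :=
      (CoherentTransport.continuous_observable T).measurable.comp measurable_subtype_coe
    have hmap : Measure.map (fun ω => CoherentTransport.observable T (a ω)) P =
        Measure.map (fun a : CoherentTransport.ComplexSphere n =>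
          CoherentTransport.observable T a) (CoherentTransport.uniformOnSphere n) := by
      rw [← ha.map_eq, AEMeasurable.map_map_of_aemeasurable hX.aemeasurable ha.aemeasurable]
      rfl
    obtain ⟨hac, hrn⟩ :=
      CoherentTransport.absolutelyContinuous_and_rnDeriv_map_observable hT hne
    refine ⟨(Real.hasPDF_iff_of_aemeasurable (hX.comp_aemeasurable ha.aemeasurable)).2
      (hmap ▸ hac), ?_, fun hinj t => ?_⟩
    · rw [pdf_def, hmap]
      exact hrn
    · rw [CoherentTransport.fundamentalBSpline,
        CoherentTransport.dividedDiff_of_injective _ _ hinj, Finset.mul_sum]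
      exact Finset.sum_congr rfl fun k _ => mul_div_assoc _ _ _
  · have h1 := isHermitian_conjTranspose_mul_self τ
    have h2 := isHermitian_conjTranspose_mul_self ρ
    exact ⟨h1, h2, (isHermitian_one.sub h1).sub h2⟩
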